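/- Let $\Theta\subseteq\mathbb R^p$ be an open, simply connected set (in particular nonempty and path connected) and let $(\rho(\theta):\theta\in\Theta)$ be a twice differentiable family of states of a $d$-dimensional quantum system, i.e. of nonnegative $d\times d$ complex matrices of trace one. A measurement $M$ with outcomes in a measurable space $\mathcal X$ is a $\sigma$-additive family of nonnegative $d\times d$ matrices $M(A)$, $A\subseteq\mathcal X$ measurable, with $M(\mathcal X)=\mathbf 1$. It has a nonnegative matrix-valued density $m$ with respect to a $\sigma$-finite measure $\nu$ (for instance $\nu(A)=\mathrm{trace}\,M(A)$), and its outcome has density $p(x;\theta)=\mathrm{trace}(\rho(\theta)m(x))$ with respect to $\nu$. Its Fisher information matrix is $$i_{rs}(\theta;M)=\mathrm E_\theta\big(l_r(\theta)\,l_s(\theta)\big),\qquad l_r=\frac{\partial}{\partial\theta^r}\log p(x;\theta).$$ The quantum scores $L_r(\theta)$ are the self-adjoint solutions of $\partial\rho/\partial\theta^r=\tfrac12(\rho L_r+L_r\rho)$, and the quantum information matrix is $$I_{jk}(\theta)=\tfrac12\,\mathrm{trace}\big(L_j\rho L_k+L_k\rho L_j\big).$$ Suppose that (i) there is a measurement $M$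 with $i(\theta;M)=I(\theta)$ for all $\theta\in\Theta$; (ii) $\rho(\theta)$ is positive (that is, positive definite) for all $\theta\in\Theta$. Then for every $\theta_0\in\Theta$ there are an observable $X$ (a self-adjoint $d\times d$ matrix) and a real function $F(x;\theta)$ of $x\in\mathbb R$ and $\theta$ (possibly depending on $\theta_0$) such that, for all $\theta\in\Theta$, $$\rho(\theta)=\exp\big(\tfrac12F(X;\theta)\big)\,\rho(\theta_0)\,\exp\big(\tfrac12F(X;\theta)\big),$$ where $F(X;\theta)$ is the function $x\mapsto F(x;\theta)$ of the observable $X$: the self-adjoint matrix $\sum_xF(x;\theta)\Pi(x)$, with $\Pi(x)$ the projection onto the eigenspace of $X$ for the eigenvalue $x$. -/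

import Mathlib

open MeasureTheory
open scoped ComplexOrder

namespace QuantumStat

/-! ### States and parametric models -/

/-- A density matrix (state) of a `d`-dimensional quantum system: a nonnegative matrix of trace
one. -/
structure IsState {d : ℕ} (ρ : Matrix (Fin d) (Fin d) ℂ) : Prop where
  posSemidef : ρ.PosSemidef
  trace_eq_one : ρ.trace = 1

/-- A matrix-valued function of a parameter in `ℝᵖ` is twice (Fréchet) differentiable on the set
`Θ`, which is meant to be open: every entry is differentiable at the points of `Θ`, and so is the
derivative of every entry. -/
def TwiceDifferentiableOn {p d : ℕ} (ρ : (Fin p → ℝ) → Matrix (Fin d) (Fin d) ℂ)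
    (Θ : Set (Fin p → ℝ)) : Prop :=
  ∀ i j, (∀ θ ∈ Θ, DifferentiableAt ℝ (fun η => ρ η i j) θ) ∧
    ∀ θ ∈ Θ, DifferentiableAt ℝ (fun η => fderiv ℝ (fun ζ => ρ ζ i j) η) θ

/-- The partial derivative `∂ρ/∂θʳ`, taken term by term. -/
noncomputable def partialDeriv {p d : ℕ} (ρ : (Fin p → ℝ) → Matrix (Fin d) (Fin d) ℂ)
    (r : Fin p) (θ : Fin p → ℝ) : Matrix (Fin d) (Fin d) ℂ :=
  Matrix.of fun i j => lineDeriv ℝ (fun η => ρ η i j) θ (Pi.single r 1)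

/-! ### The quantum score and the quantum information matrix -/

/-- `L` is a symmetric logarithmic derivative of the model `ρ` with respect to `θʳ` at `θ`: a
self-adjoint solution of `∂ρ/∂θʳ = ½ (ρ L + L ρ)`. -/
def IsQuantumScore {p d : ℕ} (ρ : (Fin p → ℝ) → Matrix (Fin d) (Fin d) ℂ) (r : Fin p)
    (θ : Fin p → ℝ) (L : Matrix (Fin d) (Fin d) ℂ) : Prop :=
  L.IsHermitian ∧ partialDeriv ρ r θ = (1 / 2 : ℂ) • (ρ θ * L + L * ρ θ)

open Classical in
/-- The quantum score of the model `ρ` with respect to `θʳ` at `θ`. For a differentiable model with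
positive definite states the symmetric logarithmic derivative exists and is unique; the value `0`
is used where there is none. -/
noncomputable def quantumScore {p d : ℕ} (ρ : (Fin p → ℝ) → Matrix (Fin d) (Fin d) ℂ)
    (r : Fin p) (θ : Fin p → ℝ) : Matrix (Fin d) (Fin d) ℂ :=
  if h : ∃ L, IsQuantumScore ρ r θ L then h.choose else 0

/-- The expected quantum information matrix,
`I(θ)ⱼₖ = ½ trace (Lⱼ ρ Lₖ + Lₖ ρ Lⱼ)` with `Lⱼ` the quantum scores. This trace is a real
number. -/
noncomputable def quantumInfo {p d : ℕ} (ρ : (Fin p → ℝ) → Matrix (Fin d) (Fin d) ℂ)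
    (θ : Fin p → ℝ) : Matrix (Fin p) (Fin p) ℝ :=
  Matrix.of fun j k => (1 / 2 : ℝ) *
    (quantumScore ρ j θ * ρ θ * quantumScore ρ k θ +
      quantumScore ρ k θ * ρ θ * quantumScore ρ j θ).trace.re

/-! ### Measurements -/

/-- A measurement with outcomes in the measurable space `𝒳`: a σ-additive family of nonnegative
matrices `M(A)` with `M(𝒳) = 1`. -/
structure Measurement (𝒳 : Type*) [MeasurableSpace 𝒳] (d : ℕ) where
  toVectorMeasure : VectorMeasure 𝒳 (Matrix (Fin d) (Fin d) ℂ)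
  posSemidef : ∀ A, MeasurableSet A → (toVectorMeasure A).PosSemidef
  univ_eq_one : toVectorMeasure Set.univ = 1

namespace Measurement

variable {𝒳 : Type*} [MeasurableSpace 𝒳] {d : ℕ}

/-- `m` is a density of the measurement `M` with respect to the measure `ν`: a measurable,
nonnegative matrix-valued function with `M(A) = ∫_A m dν` for all measurable `A`. -/
structure IsDensity (M : Measurement 𝒳 d) (ν : Measure 𝒳)
    (m : 𝒳 → Matrix (Fin d) (Fin d) ℂ) : Prop where
  measurable : ∀ i j, Measurable fun x => m x i j
  posSemidef : ∀ x, (m x).PosSemidef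
  integrable : ∀ i j, Integrable (fun x => m x i j) ν
  setIntegral_eq : ∀ A, MeasurableSet A → ∀ i j, M.toVectorMeasure A i j = ∫ x in A, m x i j ∂ν

/-- `A ↦ trace (M(A))` as a signed measure. -/
noncomputable def traceSigned (M : Measurement 𝒳 d) : SignedMeasure 𝒳 :=
  M.toVectorMeasure.mapRange
    (Complex.reAddGroupHom.comp (Matrix.traceAddMonoidHom (Fin d) ℂ))
    (Complex.continuous_re.comp (continuous_id.matrix_trace))

theorem traceSigned_apply (M : Measurement 𝒳 d) (A : Set 𝒳) :
    M.traceSigned A = (M.toVectorMeasure A).trace.re := rfl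

theorem zero_le_traceSigned (M : Measurement 𝒳 d) :
    VectorMeasure.restrict 0 Set.univ ≤ VectorMeasure.restrict M.traceSigned Set.univ :=
  VectorMeasure.restrict_le_restrict_of_subset_le _ _ fun A hA _ => by
    rw [traceSigned_apply]
    exact (Complex.le_def.1 (M.posSemidef A hA).trace_nonneg).1

/-- The measure `ν(A) = trace (M(A))`, which dominates the measurement `M`. -/
noncomputable def traceMeasure (M : Measurement 𝒳 d) : Measure 𝒳 :=
  M.traceSigned.toMeasureOfZeroLE Set.univ MeasurableSet.univ M.zero_le_traceSigned

instance (M : Measurement 𝒳 d) : IsFiniteMeasure M.traceMeasure :=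
  SignedMeasure.toMeasureOfZeroLE_finite _ _ _

theorem traceMeasure_apply (M : Measurement 𝒳 d) {A : Set 𝒳} (hA : MeasurableSet A) :
    M.traceMeasure A = ENNReal.ofReal (M.toVectorMeasure A).trace.re := by
  have h := SignedMeasure.toMeasureOfZeroLE_real_apply M.traceSigned M.zero_le_traceSigned
    MeasurableSet.univ hA
  rw [Set.univ_inter, traceSigned_apply] at h
  rw [← h, ofReal_measureReal]
  rfl

theorem eq_zero_of_traceMeasure (M : Measurement 𝒳 d) {A : Set 𝒳} (hA : M.traceMeasure A = 0) :
    M.toVectorMeasure A = 0 := by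
  by_cases hm : MeasurableSet A
  · have hp := M.posSemidef A hm
    rw [M.traceMeasure_apply hm, ENNReal.ofReal_eq_zero] at hA
    refine hp.trace_eq_zero_iff.1 (le_antisymm ?_ hp.trace_nonneg)
    have h0 := Complex.le_def.1 hp.trace_nonneg
    exact Complex.le_def.2 ⟨hA, h0.2.symm⟩
  · exact VectorMeasure.not_measurable _ hm

/-- A real-linear continuous functional of `M` has a density with respect to the trace
measure. -/
theorem exists_real_density (M : Measurement 𝒳 d) (f : Matrix (Fin d) (Fin d) ℂ →+ ℝ)
    (hf : Continuous f) : ∃ g : 𝒳 → ℝ, Measurable g ∧ Integrable g M.traceMeasure ∧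
      ∀ A, MeasurableSet A → f (M.toVectorMeasure A) = ∫ x in A, g x ∂M.traceMeasure := by
  set s : SignedMeasure 𝒳 := M.toVectorMeasure.mapRange f hf with hs
  have hac : s ≪ᵥ M.traceMeasure.toENNRealVectorMeasure := by
    refine VectorMeasure.AbsolutelyContinuous.mk fun A hA h0 => ?_
    rw [Measure.toENNRealVectorMeasure_apply_measurable hA] at h0
    rw [hs, VectorMeasure.mapRange_apply, M.eq_zero_of_traceMeasure h0, map_zero]
  refine ⟨s.rnDeriv M.traceMeasure, SignedMeasure.measurable_rnDeriv _ _,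
    SignedMeasure.integrable_rnDeriv _ _, fun A hA => ?_⟩
  rw [← withDensityᵥ_apply (SignedMeasure.integrable_rnDeriv _ _) hA,
    SignedMeasure.withDensityᵥ_rnDeriv_eq s _ hac]
  rfl

/-- Every measurement has a density with respect to its trace measure. -/
theorem exists_density (M : Measurement 𝒳 d) : ∃ m, M.IsDensity M.traceMeasure m := by
  classical
  set ν := M.traceMeasure
  have hre : ∀ i j, ∃ g : 𝒳 → ℝ, Measurable g ∧ Integrable g ν ∧
      ∀ A, MeasurableSet A → (M.toVectorMeasure A i j).re = ∫ x in A, g x ∂ν := fun i j =>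
    M.exists_real_density
      (Complex.reAddGroupHom.comp (Matrix.entryAddMonoidHom ℂ i j))
      (Complex.continuous_re.comp (continuous_id.matrix_elem i j))
  have him : ∀ i j, ∃ g : 𝒳 → ℝ, Measurable g ∧ Integrable g ν ∧
      ∀ A, MeasurableSet A → (M.toVectorMeasure A i j).im = ∫ x in A, g x ∂ν := fun i j =>
    M.exists_real_density
      (Complex.imAddGroupHom.comp (Matrix.entryAddMonoidHom ℂ i j))
      (Complex.continuous_im.comp (continuous_id.matrix_elem i j))
  choose a ha hai haA using hre
  choose b hb hbi hbA using him
  set m₀ : 𝒳 → Matrix (Fin d) (Fin d) ℂ := fun x => Matrix.of fun i j => ⟨a i j x, b i j x⟩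
    with hm₀
  have hm₀' : ∀ i j, (fun x => m₀ x i j) = fun x => (a i j x : ℂ) + (b i j x : ℂ) * Complex.I := by
    intro i j; funext x; apply Complex.ext <;> simp [hm₀]
  have hmeas : ∀ i j, Measurable fun x => m₀ x i j := by
    intro i j
    rw [hm₀']
    exact ((ha i j).complex_ofReal).add ((hb i j).complex_ofReal.mul_const _)
  have hint : ∀ i j, Integrable (fun x => m₀ x i j) ν := by
    intro i j
    rw [hm₀']
    exact (hai i j).ofReal.add ((hbi i j).ofReal.mul_const _)
  have hset : ∀ A, MeasurableSet A → ∀ i j, M.toVectorMeasure A i j = ∫ x in A, m₀ x i j ∂ν := by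
    intro A hA i j
    have e0 : ∫ x in A, ((a i j x : ℂ) + (b i j x : ℂ) * Complex.I) ∂ν =
        ∫ x in A, (a i j x : ℂ) ∂ν + ∫ x in A, (b i j x : ℂ) * Complex.I ∂ν :=
      integral_add (hai i j).ofReal.restrict ((hbi i j).ofReal.mul_const _).restrict
    rw [hm₀', e0, integral_mul_const]
    have e1 : ∫ x in A, (a i j x : ℂ) ∂ν = ((∫ x in A, a i j x ∂ν : ℝ) : ℂ) := integral_ofReal
    have e2 : ∫ x in A, (b i j x : ℂ) ∂ν = ((∫ x in A, b i j x ∂ν : ℝ) : ℂ) := integral_ofReal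
    rw [e1, e2, ← haA i j A hA, ← hbA i j A hA]
    exact (Complex.re_add_im _).symm
  have hherm : ∀ᵐ x ∂ν, (m₀ x).IsHermitian := by
    have : ∀ i j, ∀ᵐ x ∂ν, star (m₀ x j i) = m₀ x i j := by
      intro i j
      refine Integrable.ae_eq_of_forall_setIntegral_eq (fun x => star (m₀ x j i))
        (fun x => m₀ x i j) ?_ (hint i j) fun A hA _ => ?_
      · exact (Complex.conjLIE.toContinuousLinearEquiv.toContinuousLinearMap).integrable_comp
          (hint j i)
      · have h1 : ∫ x in A, star (m₀ x j i) ∂ν = star (∫ x in A, m₀ x j i ∂ν) := integral_conj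
        rw [h1, ← hset A hA, ← hset A hA]
        exact (M.posSemidef A hA).1.apply i j
    have h2 : ∀ᵐ x ∂ν, ∀ i j, star (m₀ x j i) = m₀ x i j :=
      ae_all_iff.2 fun i => ae_all_iff.2 fun j => this i j
    filter_upwards [h2] with x hx
    exact Matrix.IsHermitian.ext fun i j => hx i j
  have hquad : ∀ v : Fin d → ℂ, ∀ᵐ x ∂ν, 0 ≤ (star v ⬝ᵥ (m₀ x).mulVec v).re := by
    intro v
    have hexp : ∀ N : Matrix (Fin d) (Fin d) ℂ,
        star v ⬝ᵥ N.mulVec v = ∑ i, ∑ j, star (v i) * (N i j * v j) := by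
      intro N
      simp [dotProduct, Matrix.mulVec, Finset.mul_sum]
    have hI : Integrable (fun x => star v ⬝ᵥ (m₀ x).mulVec v) ν := by
      simp_rw [hexp]
      exact integrable_finsetSum _ fun i _ => integrable_finsetSum _ fun j _ =>
        ((hint i j).mul_const _).const_mul _
    refine ae_nonneg_of_forall_setIntegral_nonneg hI.re fun A hA _ => ?_
    have h1 : ∫ x in A, RCLike.re (star v ⬝ᵥ (m₀ x).mulVec v) ∂ν =
        RCLike.re (∫ x in A, star v ⬝ᵥ (m₀ x).mulVec v ∂ν) := integral_re hI.integrableOn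
    have h2 : ∫ x in A, star v ⬝ᵥ (m₀ x).mulVec v ∂ν =
        star v ⬝ᵥ (M.toVectorMeasure A).mulVec v := by
      simp_rw [hexp]
      rw [integral_finsetSum _ fun i _ => integrable_finsetSum _ fun j _ =>
        (((hint i j).mul_const _).const_mul _).integrableOn]
      refine Finset.sum_congr rfl fun i _ => ?_
      rw [integral_finsetSum _ fun j _ => (((hint i j).mul_const _).const_mul _).integrableOn]
      refine Finset.sum_congr rfl fun j _ => ?_
      rw [integral_const_mul, integral_mul_const, hset A hA i j]
    refine le_of_le_of_eq ?_ h1.symm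
    rw [h2]
    exact (Complex.le_def.1 ((M.posSemidef A hA).dotProduct_mulVec_nonneg v)).1
  have hpos : ∀ᵐ x ∂ν, (m₀ x).PosSemidef := by
    have hall : ∀ᵐ x ∂ν, ∀ n, 0 ≤ (star (TopologicalSpace.denseSeq (Fin d → ℂ) n) ⬝ᵥ
        (m₀ x).mulVec (TopologicalSpace.denseSeq (Fin d → ℂ) n)).re :=
      ae_all_iff.2 fun n => hquad _
    filter_upwards [hherm, hall] with x hx1 hx2
    refine Matrix.PosSemidef.of_dotProduct_mulVec_nonneg hx1 fun v => ?_
    have hc : Continuous fun v : Fin d → ℂ => (star v ⬝ᵥ (m₀ x).mulVec v).re := by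
      simp only [dotProduct, Matrix.mulVec]
      fun_prop
    have hcl : IsClosed {v : Fin d → ℂ | 0 ≤ (star v ⬝ᵥ (m₀ x).mulVec v).re} :=
      isClosed_le continuous_const hc
    have hv : v ∈ {v : Fin d → ℂ | 0 ≤ (star v ⬝ᵥ (m₀ x).mulVec v).re} := by
      have hd := (TopologicalSpace.denseRange_denseSeq (Fin d → ℂ)).closure_eq
      have hsub : Set.range (TopologicalSpace.denseSeq (Fin d → ℂ)) ⊆
          {v : Fin d → ℂ | 0 ≤ (star v ⬝ᵥ (m₀ x).mulVec v).re} := by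
        rintro _ ⟨n, rfl⟩
        exact hx2 n
      exact closure_minimal hsub hcl (hd ▸ Set.mem_univ v)
    refine Complex.le_def.2 ⟨hv, ?_⟩
    exact (hx1.im_star_dotProduct_mulVec_self v).symm
  obtain ⟨S, hS, hSm, hSν⟩ : ∃ S : Set 𝒳, (∀ x ∈ S, (m₀ x).PosSemidef) ∧ MeasurableSet S ∧
      ν Sᶜ = 0 := by
    obtain ⟨T, hT, hTm, hT0⟩ := exists_measurable_superset_of_null (ae_iff.1 hpos)
    refine ⟨Tᶜ, fun x hx => ?_, hTm.compl, by rwa [compl_compl]⟩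
    by_contra h
    exact hx (hT h)
  have hae : ∀ i j, (fun x => (if x ∈ S then m₀ x else 0) i j) =ᵐ[ν] fun x => m₀ x i j := by
    intro i j
    have : ∀ᵐ x ∂ν, x ∈ S := hSν
    filter_upwards [this] with x hx
    simp [hx]
  refine ⟨fun x => if x ∈ S then m₀ x else 0, ?_, ?_, ?_, ?_⟩
  · intro i j
    have : (fun x => (if x ∈ S then m₀ x else 0) i j) = fun x => if x ∈ S then m₀ x i j else 0 := by
      funext x; split_ifs <;> simp
    rw [this]
    exact (hmeas i j).ite hSm measurable_const
  · intro x
    by_cases hx : x ∈ S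
    · simpa [hx] using hS x hx
    · simpa [hx] using Matrix.PosSemidef.zero
  · exact fun i j => (hint i j).congr (hae i j).symm
  · intro A hA i j
    rw [hset A hA i j]
    exact (integral_congr_ae (ae_restrict_of_ae (hae i j))).symm

/-- A density of the measurement `M` with respect to its trace measure (unique up to null
sets). -/
noncomputable def density (M : Measurement 𝒳 d) : 𝒳 → Matrix (Fin d) (Fin d) ℂ :=
  M.exists_density.choose

theorem isDensity_density (M : Measurement 𝒳 d) : M.IsDensity M.traceMeasure M.density :=
  M.exists_density.choose_spec

end Measurement

/-! ### The Fisher information matrix of a measurement -/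

/-- The density `p(x;θ) = trace (ρ(θ) m(x))` of the outcome of a measurement with density `m`. -/
noncomputable def outcomeDensity {p d : ℕ} {𝒳 : Type*}
    (ρ : (Fin p → ℝ) → Matrix (Fin d) (Fin d) ℂ) (m : 𝒳 → Matrix (Fin d) (Fin d) ℂ)
    (x : 𝒳) (θ : Fin p → ℝ) : ℝ :=
  (ρ θ * m x).trace.re

/-- The likelihood score `l_r = ∂ log p(x;θ) / ∂θʳ`. -/
noncomputable def score {p d : ℕ} {𝒳 : Type*}
    (ρ : (Fin p → ℝ) → Matrix (Fin d) (Fin d) ℂ) (m : 𝒳 → Matrix (Fin d) (Fin d) ℂ)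
    (r : Fin p) (x : 𝒳) (θ : Fin p → ℝ) : ℝ :=
  lineDeriv ℝ (fun η => Real.log (outcomeDensity ρ m x η)) θ (Pi.single r 1)

/-- The Fisher information matrix `E_θ (l_r l_s)` of the outcome of a measurement with density `m`
with respect to `ν`. -/
noncomputable def fisherInfoOfDensity {p d : ℕ} {𝒳 : Type*} [MeasurableSpace 𝒳]
    (ρ : (Fin p → ℝ) → Matrix (Fin d) (Fin d) ℂ) (ν : Measure 𝒳)
    (m : 𝒳 → Matrix (Fin d) (Fin d) ℂ) (θ : Fin p → ℝ) : Matrix (Fin p) (Fin p) ℝ :=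
  Matrix.of fun r s => ∫ x, score ρ m r x θ * score ρ m s x θ * outcomeDensity ρ m x θ ∂ν

/-- The Fisher information matrix `i(θ;M)` of the outcome of the measurement `M`. It is computed
from the dominating measure `A ↦ trace (M(A))`; every other σ-finite dominating measure gives the
same matrix. -/
noncomputable def Measurement.fisherInfo {p d : ℕ} {𝒳 : Type*} [MeasurableSpace 𝒳]
    (M : Measurement 𝒳 d) (ρ : (Fin p → ℝ) → Matrix (Fin d) (Fin d) ℂ) (θ : Fin p → ℝ) :
    Matrix (Fin p) (Fin p) ℝ :=
  fisherInfoOfDensity ρ M.traceMeasure M.density θ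

end QuantumStat

/-!
Let `L_r(θ)` be the quantum scores and `m` a density of the measurement. The Fisher information is
bounded by the quantum information because, with `c` the likelihood score of the outcome `x`,
`Re trace ((L_r - c) m(x) (L_r - c) ρ)` is nonnegative and integrates to `I_rr - i_rr`. Under
equality it vanishes almost everywhere, and since `ρ` is positive definite this forces
`L_r(θ) m(x) = c m(x)` (`QuantumStat.ae_quantumScore_mul_density`). So all the quantum scores, for
all `r` and `θ`, act on `m(x)` by scalars; as `m` integrates to the identity, they commute
(`QuantumStat.commute_of_ae_mul_eq_smul`) and one unitary matrix diagonalizes them all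
(`QuantumStat.exists_unitary_forall_eq_diagonal`).

In the diagonalizing basis the equation `∂_r ρ = ½ (ρ L_r + L_r ρ)` decouples into scalar equations
`∂_r ρ_ij = ½ (l_i + l_j) ρ_ij`. Those on the diagonal give `l_i = ∂_r log ρ_ii`, so an explicit
potential of the scores is available and connectedness of the parameter set suffices to integrate
the other equations (`QuantumStat.eq_diagonal_mul_mul_diagonal_of_score_diagonal`). The observable
`X` is diagonal in this basis with distinct eigenvalues, so that every real diagonal matrix is a
function of it.
-/

namespace QuantumStat

/-! ### Positive matrices and the Lyapunov equation -/

section Matrix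

open Matrix

variable {n : Type*} [Fintype n] [DecidableEq n]

theorem exists_eq_conjTranspose_mul_self {A : Matrix n n ℂ} (hA : A.PosSemidef) :
    ∃ B : Matrix n n ℂ, A = Bᴴ * B := by
  open scoped MatrixOrder Matrix.Norms.L2Operator in
  exact CStarAlgebra.nonneg_iff_eq_star_mul_self.mp hA.nonneg

/-- The Hermitian form `(S, T) ↦ trace (S ρ Tᴴ)` of a positive definite `ρ` is definite. -/
theorem eq_zero_of_trace_mul_mul_conjTranspose {σ T : Matrix n n ℂ} (hσ : σ.PosDef)
    (h : (T * σ * Tᴴ).trace = 0) : T = 0 := by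
  obtain ⟨C, rfl⟩ := exists_eq_conjTranspose_mul_self hσ.posSemidef
  have h1 : C * Tᴴ = 0 := by
    rw [← trace_conjTranspose_mul_self_eq_zero_iff, ← h]
    simp [Matrix.mul_assoc]
  have h2 : (Cᴴ * C) * Tᴴ = 0 := by rw [Matrix.mul_assoc, h1, Matrix.mul_zero]
  have h3 : Tᴴ = 0 := by simpa using (hσ.isUnit.mul_right_eq_zero).1 h2
  simpa using h3

theorem re_trace_mul_mul_mul_nonneg {σ m K : Matrix n n ℂ} (hσ : σ.PosSemidef)
    (hm : m.PosSemidef) (hK : K.IsHermitian) : 0 ≤ (K * m * K * σ).trace.re := by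
  obtain ⟨D, rfl⟩ := exists_eq_conjTranspose_mul_self hm
  have h : (K * (Dᴴ * D) * K * σ).trace = (D * K * σ * (D * K)ᴴ).trace := by
    rw [Matrix.trace_mul_comm (D * K * σ), conjTranspose_mul, hK.eq]
    simp only [Matrix.mul_assoc]
  rw [h]
  exact (Complex.le_def.1 (hσ.mul_mul_conjTranspose_same (D * K)).trace_nonneg).1

theorem mul_eq_zero_of_re_trace_eq_zero {σ m K : Matrix n n ℂ} (hσ : σ.PosDef)
    (hm : m.PosSemidef) (hK : K.IsHermitian) (h0 : (K * m * K * σ).trace.re = 0) : K * m = 0 := by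
  obtain ⟨D, rfl⟩ := exists_eq_conjTranspose_mul_self hm
  have h : (K * (Dᴴ * D) * K * σ).trace = (D * K * σ * (D * K)ᴴ).trace := by
    rw [Matrix.trace_mul_comm (D * K * σ), conjTranspose_mul, hK.eq]
    simp only [Matrix.mul_assoc]
  rw [h] at h0
  have hDK : D * K = 0 := by
    refine eq_zero_of_trace_mul_mul_conjTranspose hσ (Complex.ext h0 ?_)
    exact (Complex.le_def.1
      (hσ.posSemidef.mul_mul_conjTranspose_same (D * K)).trace_nonneg).2.symm
  have h1 : K * Dᴴ = 0 := by
    have := congrArg conjTranspose hDK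
    rwa [conjTranspose_mul, hK.eq, conjTranspose_zero] at this
  rw [← Matrix.mul_assoc, h1, Matrix.zero_mul]

theorem re_trace_mul_pos {σ m : Matrix n n ℂ} (hσ : σ.PosDef) (hm : m.PosSemidef) (h0 : m ≠ 0) :
    0 < (σ * m).trace.re := by
  have e : (1 * m * 1 * σ).trace = (σ * m).trace := by
    rw [Matrix.one_mul, Matrix.mul_one, Matrix.trace_mul_comm]
  rw [← e]
  refine lt_of_le_of_ne (re_trace_mul_mul_mul_nonneg hσ.posSemidef hm isHermitian_one)
    fun h => h0 ?_
  simpa using mul_eq_zero_of_re_trace_eq_zero hσ hm isHermitian_one h.symm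

theorem eq_zero_of_mul_add_mul_eq_zero {σ L : Matrix n n ℂ} (hσ : σ.PosDef)
    (h : σ * L + L * σ = 0) : L = 0 := by
  have h1 : (Lᴴ * σ * Lᴴᴴ).trace + (L * σ * Lᴴ).trace = 0 := by
    rw [conjTranspose_conjTranspose, Matrix.trace_mul_comm (L * σ), ← trace_add, Matrix.mul_assoc,
      ← Matrix.mul_add, h]
    simp
  exact eq_zero_of_trace_mul_mul_conjTranspose hσ
    ((add_eq_zero_iff_of_nonneg (hσ.posSemidef.mul_mul_conjTranspose_same _).trace_nonneg
      (hσ.posSemidef.mul_mul_conjTranspose_same _).trace_nonneg).1 h1).2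

/-- The Lyapunov equation `D = ½ (σ L + L σ)` has a self-adjoint solution: `L ↦ σ L + L σ` is
injective for positive definite `σ`, hence bijective, and `Lᴴ` solves the equation if `L` does. -/
theorem exists_isHermitian_eq_half_mul_add_mul {σ D : Matrix n n ℂ} (hσ : σ.PosDef)
    (hD : D.IsHermitian) :
    ∃ L : Matrix n n ℂ, L.IsHermitian ∧ D = (1 / 2 : ℂ) • (σ * L + L * σ) := by
  set φ : Matrix n n ℂ →ₗ[ℂ] Matrix n n ℂ :=
    LinearMap.mulLeft ℂ σ + LinearMap.mulRight ℂ σ with hφ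
  have hφa : ∀ L, φ L = σ * L + L * σ := fun L => by simp [hφ]
  have hinj : Function.Injective φ := by
    rw [← LinearMap.ker_eq_bot, LinearMap.ker_eq_bot']
    intro L hL
    exact eq_zero_of_mul_add_mul_eq_zero hσ (by rw [← hφa, hL])
  obtain ⟨L, hL⟩ := LinearMap.injective_iff_surjective.1 hinj ((2 : ℂ) • D)
  refine ⟨L, hinj ?_, ?_⟩
  · have : φ Lᴴ = (φ L)ᴴ := by
      rw [hφa, hφa, conjTranspose_add, conjTranspose_mul, conjTranspose_mul, hσ.isHermitian.eq,
        add_comm]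
    rw [this, hL, conjTranspose_smul, hD.eq]
    simp
  · rw [← hφa, hL, smul_smul]
    norm_num

/-! ### Simultaneous diagonalization and functions of a diagonalized matrix -/

open Module.End in
/-- A commuting family of self-adjoint matrices, of any size, is diagonalized by one unitary
matrix. -/
theorem exists_unitary_forall_eq_diagonal {ι : Type*} (L : ι → Matrix n n ℂ)
    (hL : ∀ i, (L i).IsHermitian) (hc : ∀ i j, Commute (L i) (L j)) :
    ∃ U ∈ unitary (Matrix n n ℂ), ∀ i, ∃ l : n → ℂ, Uᴴ * L i * U = diagonal l := by
  classical
  set T : ι → EuclideanSpace ℂ n →ₗ[ℂ] EuclideanSpace ℂ n := fun i => (L i).toEuclideanLin with hT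
  have hTs : ∀ i, (T i).IsSymmetric := fun i => isSymmetric_toEuclideanLin_iff.2 (hL i)
  have hTc : Pairwise (Function.onFun Commute T) := fun i j _ => by
    refine LinearMap.ext fun v => ?_
    simp only [hT, Module.End.mul_apply, toLpLin_apply, mulVec_mulVec, (hc i j).eq]
  set V : (ι → ℂ) → Submodule ℂ (EuclideanSpace ℂ n) := fun γ => ⨅ j, eigenspace (T j) (γ j)
  have hint : DirectSum.IsInternal V :=
    LinearMap.IsSymmetric.directSum_isInternal_of_pairwise_commute hTs hTc
  have hV := LinearMap.IsSymmetric.orthogonalFamily_iInf_eigenspaces hTs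
  -- Only finitely many joint eigenspaces are nonzero; these carry an orthonormal basis.
  have : Fintype {γ // V γ ≠ ⊥} := hint.submodule_iSupIndep.fintypeNeBotOfFiniteDimensional
  have hint' : DirectSum.IsInternal fun γ : {γ // V γ ≠ ⊥} => V γ :=
    DirectSum.isInternal_ne_bot_iff.2 hint
  have hV' : OrthogonalFamily ℂ (fun γ : {γ // V γ ≠ ⊥} => V γ) fun γ => (V γ).subtypeₗᵢ :=
    hV.comp Subtype.val_injective
  have hcard : Module.finrank ℂ (EuclideanSpace ℂ n) = Fintype.card n := by simp
  set b : OrthonormalBasis n ℂ (EuclideanSpace ℂ n) :=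
    (hint'.subordinateOrthonormalBasis hcard hV').reindex (Fintype.equivFin n).symm with hb
  have hmem : ∀ k, ∃ γ : ι → ℂ, ∀ i, T i (b k) = γ i • b k := by
    intro k
    refine ⟨(hint'.subordinateOrthonormalBasisIndex hcard (Fintype.equivFin n k) hV').1,
      fun i => ?_⟩
    have h := hint'.subordinateOrthonormalBasis_subordinate hcard (Fintype.equivFin n k) hV'
    have h2 := (Submodule.mem_iInf _).1 h i
    rw [hb, OrthonormalBasis.reindex_apply]
    exact mem_eigenspace_iff.1 h2
  choose γ hγ using hmem
  set U : Matrix n n ℂ := (EuclideanSpace.basisFun n ℂ).toBasis.toMatrix b with hU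
  have hUu : U ∈ unitary (Matrix n n ℂ) :=
    (EuclideanSpace.basisFun n ℂ).toMatrix_orthonormalBasis_mem_unitary b
  have hUa : ∀ r k, U r k = b k r := fun r k => by
    simp [hU, Module.Basis.toMatrix_apply]
  refine ⟨U, hUu, fun i => ⟨fun k => γ k i, ?_⟩⟩
  have hLU : L i * U = U * diagonal fun k => γ k i := by
    ext r k
    have h := congrArg (fun v => v r) (hγ k i)
    simp only [hT, toLpLin_apply, PiLp.smul_apply, smul_eq_mul] at h
    rw [mul_diagonal, hUa, mul_comm, ← h, Matrix.mul_apply, mulVec, dotProduct]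
    exact Finset.sum_congr rfl fun s _ => by rw [hUa]
  rw [Matrix.mul_assoc, hLU, ← Matrix.mul_assoc]
  have : Uᴴ * U = 1 := (Unitary.mem_iff.1 hUu).1
  rw [this, Matrix.one_mul]

open Polynomial in
theorem aeval_mul_diagonal_mul_conjTranspose {U : Matrix n n ℂ} (hU : U ∈ unitary (Matrix n n ℂ))
    (x : n → ℝ) (q : ℝ[X]) :
    aeval (U * diagonal (fun i => (x i : ℂ)) * Uᴴ) q =
      U * diagonal (fun i => ((q.eval (x i) : ℝ) : ℂ)) * Uᴴ := by
  have h1 : Uᴴ * U = 1 := (Unitary.mem_iff.1 hU).1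
  have h2 : U * Uᴴ = 1 := (Unitary.mem_iff.1 hU).2
  induction q using Polynomial.induction_on with
  | C r =>
    have : diagonal (fun _ : n => (r : ℂ)) = algebraMap ℝ (Matrix n n ℂ) r := by
      ext i j
      simp [Matrix.algebraMap_matrix_apply, diagonal_apply]
    simp only [aeval_C, eval_C]
    rw [this, ← Algebra.commutes, Matrix.mul_assoc, h2, Matrix.mul_one]
  | add q₁ q₂ hq₁ hq₂ =>
    simp only [map_add, hq₁, hq₂, eval_add, Complex.ofReal_add, ← diagonal_add, Matrix.mul_add,
      Matrix.add_mul]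
  | monomial k r ih =>
    rw [pow_succ, ← mul_assoc, map_mul, ih, aeval_X]
    calc _ = U * diagonal (fun i => (((C r * X ^ k).eval (x i) : ℝ) : ℂ)) * (Uᴴ * U) *
          diagonal (fun i => (x i : ℂ)) * Uᴴ := by simp only [Matrix.mul_assoc]
      _ = _ := by
        rw [h1, Matrix.mul_one, Matrix.mul_assoc U, diagonal_mul_diagonal]
        simp

theorem isHermitian_mul_diagonal_mul_conjTranspose (U : Matrix n n ℂ) (x : n → ℝ) :
    (U * diagonal (fun i => (x i : ℂ)) * Uᴴ).IsHermitian :=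
  isHermitian_mul_mul_conjTranspose U (isHermitian_diagonal_iff.2 fun i => by
    simp [isSelfAdjoint_iff])

/-- On finite sets functions are polynomials, so the functional calculus of a diagonalized matrix
acts on the eigenvalues. -/
theorem cfc_mul_diagonal_mul_conjTranspose {U : Matrix n n ℂ} (hU : U ∈ unitary (Matrix n n ℂ))
    (x : n → ℝ) (f : ℝ → ℝ) :
    cfc f (U * diagonal (fun i => (x i : ℂ)) * Uᴴ) =
      U * diagonal (fun i => (f (x i) : ℂ)) * Uᴴ := by
  set X := U * diagonal (fun i => (x i : ℂ)) * Uᴴ with hX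
  have hXh : X.IsHermitian := isHermitian_mul_diagonal_mul_conjTranspose U x
  have hfin : (spectrum ℝ X ∪ Set.range x).Finite :=
    (Matrix.finite_real_spectrum).union (Set.finite_range x)
  set q := Lagrange.interpolate hfin.toFinset id f with hq
  have hqe : ∀ y ∈ spectrum ℝ X ∪ Set.range x, q.eval y = f y := fun y hy =>
    Lagrange.eval_interpolate_at_node (v := id) f Function.injective_id.injOn
      (hfin.mem_toFinset.2 hy)
  have h1 : cfc f X = cfc q.eval X := cfc_congr fun y hy => (hqe y (Or.inl hy)).symm
  rw [h1, cfc_polynomial q X hXh.isSelfAdjoint, hX, aeval_mul_diagonal_mul_conjTranspose hU]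
  simp only [hqe _ (Or.inr (Set.mem_range_self _))]

theorem exp_mul_diagonal_mul_conjTranspose {U : Matrix n n ℂ} (hU : U ∈ unitary (Matrix n n ℂ))
    (v : n → ℂ) :
    NormedSpace.exp (U * diagonal v * Uᴴ) = U * diagonal (fun i => Complex.exp (v i)) * Uᴴ := by
  have h1 : Uᴴ * U = 1 := (Unitary.mem_iff.1 hU).1
  have hinv : U⁻¹ = Uᴴ := Matrix.inv_eq_left_inv h1
  rw [← hinv, Matrix.exp_conj U _ ((Matrix.isUnit_iff_isUnit_det U).2
    (Matrix.isUnit_det_of_left_inverse h1)), Matrix.exp_diagonal]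
  congr 3
  funext i
  rw [Pi.coe_exp, Complex.exp_eq_exp_ℂ]

end Matrix

/-! ### Derivatives of linear functions of the state -/

section Derivative

variable {p d : ℕ} {ρ : (Fin p → ℝ) → Matrix (Fin d) (Fin d) ℂ} {Θ : Set (Fin p → ℝ)}
  {θ : Fin p → ℝ} {E : Type*} [NormedAddCommGroup E] [NormedSpace ℝ E]

/-- A real-linear map of matrices as a continuous linear map on arrays, which carry a norm. -/
noncomputable def arrayCLM (φ : Matrix (Fin d) (Fin d) ℂ →ₗ[ℝ] E) :
    (Fin d → Fin d → ℂ) →L[ℝ] E :=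
  LinearMap.toContinuousLinearMap
    (φ.comp (Matrix.ofLinearEquiv ℝ : (Fin d → Fin d → ℂ) ≃ₗ[ℝ] _).toLinearMap)

theorem hasFDerivAt_array (hρ : TwiceDifferentiableOn ρ Θ) (hθ : θ ∈ Θ) :
    HasFDerivAt (𝕜 := ℝ) (fun η => (fun i j => ρ η i j : Fin d → Fin d → ℂ))
      (ContinuousLinearMap.pi fun i => ContinuousLinearMap.pi fun j =>
        fderiv ℝ (fun η => ρ η i j) θ) θ :=
  hasFDerivAt_pi.2 fun i => hasFDerivAt_pi.2 fun j => ((hρ i j).1 θ hθ).hasFDerivAt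

theorem differentiableAt_linearMap_comp (hρ : TwiceDifferentiableOn ρ Θ) (hθ : θ ∈ Θ)
    (φ : Matrix (Fin d) (Fin d) ℂ →ₗ[ℝ] E) : DifferentiableAt ℝ (fun η => φ (ρ η)) θ :=
  ((arrayCLM φ).hasFDerivAt.comp θ (hasFDerivAt_array hρ hθ)).differentiableAt

theorem fderiv_linearMap_comp (hρ : TwiceDifferentiableOn ρ Θ) (hθ : θ ∈ Θ)
    (φ : Matrix (Fin d) (Fin d) ℂ →ₗ[ℝ] E) (r : Fin p) :
    fderiv ℝ (fun η => φ (ρ η)) θ (Pi.single r 1) = φ (partialDeriv ρ r θ) := by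
  have h := ((arrayCLM φ).hasFDerivAt.comp θ (hasFDerivAt_array hρ hθ)).fderiv
  have h2 : (fun η => φ (ρ η)) =
      (arrayCLM φ) ∘ fun η => (fun i j => ρ η i j : Fin d → Fin d → ℂ) := rfl
  rw [h2, h]
  change φ (Matrix.of _) = φ (Matrix.of _)
  congr 2
  funext i j
  exact ((hρ i j).1 θ hθ).lineDeriv_eq_fderiv.symm

theorem isHermitian_partialDeriv (hΘ : IsOpen Θ) (hρ : TwiceDifferentiableOn ρ Θ)
    (hH : ∀ θ ∈ Θ, (ρ θ).IsHermitian) (hθ : θ ∈ Θ) (r : Fin p) :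
    (partialDeriv ρ r θ).IsHermitian := by
  refine Matrix.IsHermitian.ext fun i j => ?_
  have h1 := fderiv_linearMap_comp hρ hθ
    (Complex.conjLIE.toLinearEquiv.toLinearMap ∘ₗ Matrix.entryLinearMap ℝ ℂ j i) r
  have h2 := fderiv_linearMap_comp hρ hθ (Matrix.entryLinearMap ℝ ℂ i j) r
  refine Eq.trans (Eq.trans h1.symm ?_) h2
  have he : (fun η => (Complex.conjLIE.toLinearEquiv.toLinearMap ∘ₗ
      Matrix.entryLinearMap ℝ ℂ j i) (ρ η)) =ᶠ[nhds θ]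
      fun η => Matrix.entryLinearMap ℝ ℂ i j (ρ η) := by
    filter_upwards [hΘ.mem_nhds hθ] with η hη
    exact (hH η hη).apply i j
  rw [he.fderiv_eq]

theorem isQuantumScore_quantumScore (hΘ : IsOpen Θ) (hρ : TwiceDifferentiableOn ρ Θ)
    (hpos : ∀ θ ∈ Θ, (ρ θ).PosDef) (hθ : θ ∈ Θ) (r : Fin p) :
    IsQuantumScore ρ r θ (quantumScore ρ r θ) := by
  have h : ∃ L, IsQuantumScore ρ r θ L :=
    exists_isHermitian_eq_half_mul_add_mul (hpos θ hθ)
      (isHermitian_partialDeriv hΘ hρ (fun θ hθ => (hpos θ hθ).isHermitian) hθ r)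
  rw [quantumScore, dif_pos h]
  exact h.choose_spec

end Derivative

/-! ### Integration of linear functions of the density of a measurement -/

section Integral

variable {𝒳 : Type*} [MeasurableSpace 𝒳] {d : ℕ} {M : Measurement 𝒳 d} {ν : Measure 𝒳}
  {m : 𝒳 → Matrix (Fin d) (Fin d) ℂ}
  {E : Type*} [NormedAddCommGroup E] [NormedSpace ℝ E]

theorem Measurement.IsDensity.integrable_linearMap (hm : M.IsDensity ν m)
    (φ : Matrix (Fin d) (Fin d) ℂ →ₗ[ℝ] E) : Integrable (fun x => φ (m x)) ν := by
  have h : Integrable (fun x => (fun i j => m x i j : Fin d → Fin d → ℂ)) ν :=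
    Integrable.of_eval fun i => Integrable.of_eval fun j => hm.integrable i j
  exact (arrayCLM φ).integrable_comp h

theorem Measurement.IsDensity.integral_linearMap [CompleteSpace E] (hm : M.IsDensity ν m)
    (φ : Matrix (Fin d) (Fin d) ℂ →ₗ[ℝ] E) : ∫ x, φ (m x) ∂ν = φ 1 := by
  have h : ∀ i, Integrable (fun x => (fun j => m x i j : Fin d → ℂ)) ν :=
    fun i => Integrable.of_eval fun j => hm.integrable i j
  have h' : Integrable (fun x => (fun i j => m x i j : Fin d → Fin d → ℂ)) ν :=
    Integrable.of_eval h
  have h1 := (arrayCLM φ).integral_comp_comm h'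
  refine h1.trans ?_
  change φ (Matrix.of _) = φ 1
  congr 1
  ext i j
  rw [Matrix.of_apply, eval_integral h, eval_integral (hm.integrable i), ← M.univ_eq_one,
    hm.setIntegral_eq _ MeasurableSet.univ, Measure.restrict_univ]

end Integral

/-! ### Attainment of the quantum information bound -/

section Attainment

variable {p d : ℕ} {ρ : (Fin p → ℝ) → Matrix (Fin d) (Fin d) ℂ} {Θ : Set (Fin p → ℝ)}
  {θ : Fin p → ℝ}

open Matrix

/-- The real-linear functional `N ↦ Re trace (A N B)`. -/
noncomputable def reTraceMul (A B : Matrix (Fin d) (Fin d) ℂ) :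
    Matrix (Fin d) (Fin d) ℂ →ₗ[ℝ] ℝ :=
  Complex.reLm ∘ₗ Matrix.traceLinearMap (Fin d) ℝ ℂ ∘ₗ LinearMap.mulLeft ℝ A ∘ₗ
    LinearMap.mulRight ℝ B

theorem reTraceMul_apply (A B N : Matrix (Fin d) (Fin d) ℂ) :
    reTraceMul A B N = (A * (N * B)).trace.re := rfl

theorem re_trace_conjTranspose (A : Matrix (Fin d) (Fin d) ℂ) :
    Aᴴ.trace.re = A.trace.re := by
  rw [Matrix.trace_conjTranspose]; exact Complex.conj_re _

/-- The likelihood score is `Re trace (ρ L m) / trace (ρ m)`, where `L` is the quantum score. -/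
theorem score_eq {𝒳 : Type*} {m : 𝒳 → Matrix (Fin d) (Fin d) ℂ} {x : 𝒳}
    (hρ : TwiceDifferentiableOn ρ Θ) (hpos : ∀ θ ∈ Θ, (ρ θ).PosDef) (hm : (m x).PosSemidef)
    (hθ : θ ∈ Θ) {r : Fin p} {L : Matrix (Fin d) (Fin d) ℂ} (hL : IsQuantumScore ρ r θ L) :
    score ρ m r x θ = (ρ θ * L * m x).trace.re / outcomeDensity ρ m x θ := by
  by_cases h0 : m x = 0
  -- Where `m x = 0` the outcome density is identically zero, and both sides have the value `0`.
  · have : (fun η => Real.log (outcomeDensity ρ m x η)) = fun _ => 0 := by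
      funext η; simp [outcomeDensity, h0]
    rw [score, this]
    simp [h0, lineDeriv]
  · have hp : 0 < outcomeDensity ρ m x θ := re_trace_mul_pos (hpos θ hθ) hm h0
    have hφ : ∀ η, outcomeDensity ρ m x η = reTraceMul 1 (m x) (ρ η) := fun η => by
      rw [reTraceMul_apply, Matrix.one_mul, outcomeDensity]
    have hd : DifferentiableAt ℝ (fun η => outcomeDensity ρ m x η) θ := by
      simp_rw [hφ]
      exact differentiableAt_linearMap_comp hρ hθ _
    have hf : fderiv ℝ (fun η => outcomeDensity ρ m x η) θ (Pi.single r 1) =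
        (ρ θ * L * m x).trace.re := by
      simp_rw [hφ]
      rw [fderiv_linearMap_comp hρ hθ, hL.2, reTraceMul_apply, Matrix.one_mul]
      have h1 : (L * ρ θ * m x).trace.re = (ρ θ * L * m x).trace.re := by
        rw [← re_trace_conjTranspose, conjTranspose_mul, conjTranspose_mul, hL.1.eq,
          (hpos θ hθ).isHermitian.eq, hm.isHermitian.eq, Matrix.trace_mul_comm]
      rw [smul_mul_assoc, Matrix.add_mul, trace_smul, trace_add, smul_eq_mul]
      have h2 : ((1 / 2 : ℂ) * ((ρ θ * L * m x).trace + (L * ρ θ * m x).trace)).re =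
          1 / 2 * ((ρ θ * L * m x).trace.re + (L * ρ θ * m x).trace.re) := by
        rw [show (1 / 2 : ℂ) = ((1 / 2 : ℝ) : ℂ) by norm_num, Complex.re_ofReal_mul, Complex.add_re]
      rw [h2, h1]
      ring
    rw [score, (hd.log hp.ne').lineDeriv_eq_fderiv, fderiv.log hd hp.ne',
      _root_.smul_apply, hf, smul_eq_mul, div_eq_inv_mul]

/-- Completing the square in `c`. For `c` the likelihood score of an outcome with density `N`, the
right-hand side is the contribution of that outcome to the quantum information minus its
contribution to the Fisher information. -/
theorem re_trace_sub_smul {σ L N : Matrix (Fin d) (Fin d) ℂ} (hσ : σ.IsHermitian)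
    (hL : L.IsHermitian) (hN : N.IsHermitian) (c : ℝ) :
    ((L - (c : ℂ) • 1) * N * (L - (c : ℂ) • 1) * σ).trace.re =
      (L * N * L * σ).trace.re - 2 * c * (σ * L * N).trace.re + c ^ 2 * (σ * N).trace.re := by
  have h1 : (N * L * σ).trace.re = (σ * L * N).trace.re := by
    rw [← re_trace_conjTranspose, conjTranspose_mul, conjTranspose_mul, hL.eq, hσ.eq, hN.eq,
      ← Matrix.mul_assoc]
  have h2 : (L * N * σ).trace.re = (σ * L * N).trace.re := by
    rw [Matrix.trace_mul_comm, ← Matrix.mul_assoc]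
  have h3 : (N * σ).trace.re = (σ * N).trace.re := by rw [Matrix.trace_mul_comm]
  have e : (L - (c : ℂ) • 1) * N * (L - (c : ℂ) • 1) * σ =
      L * N * L * σ - (c : ℂ) • (L * N * σ) - (c : ℂ) • (N * L * σ) +
        ((c ^ 2 : ℝ) : ℂ) • (N * σ) := by
    simp only [Matrix.sub_mul, Matrix.mul_sub, smul_mul_assoc, mul_smul_comm, Matrix.one_mul,
      Matrix.mul_one, smul_sub, smul_smul, sq, Complex.ofReal_mul]
    abel
  rw [e]
  simp only [trace_add, trace_sub, trace_smul, smul_eq_mul, Complex.add_re, Complex.sub_re,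
    Complex.re_ofReal_mul, h1, h2, h3]
  ring

/-- If the Fisher information attains the quantum information in the direction `r`, then the
density of the measurement is almost everywhere supported in an eigenspace of the quantum score:
the integrated defect `∫ Re trace ((L - c) m (L - c) ρ)` of the information inequality vanishes,
where `c` is the likelihood score. -/
theorem ae_quantumScore_mul_density {𝒳 : Type*} [MeasurableSpace 𝒳] {M : Measurement 𝒳 d}
    {ν : Measure 𝒳} {m : 𝒳 → Matrix (Fin d) (Fin d) ℂ} (hm : M.IsDensity ν m) (hΘ : IsOpen Θ)
    (hρ : TwiceDifferentiableOn ρ Θ) (hpos : ∀ θ ∈ Θ, (ρ θ).PosDef) (hθ : θ ∈ Θ) (r : Fin p)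
    (hI : fisherInfoOfDensity ρ ν m θ r r = quantumInfo ρ θ r r) :
    ∀ᵐ x ∂ν, quantumScore ρ r θ * m x = ((score ρ m r x θ : ℝ) : ℂ) • m x := by
  have hLs := isQuantumScore_quantumScore hΘ hρ hpos hθ r
  set L := quantumScore ρ r θ
  set σ := ρ θ
  have hσ : σ.PosDef := hpos θ hθ
  set c : 𝒳 → ℝ := fun x => score ρ m r x θ
  set q : 𝒳 → ℝ := fun x => outcomeDensity ρ m x θ
  have hc : ∀ x, c x = (σ * L * m x).trace.re / q x := fun x =>
    score_eq hρ hpos (hm.posSemidef x) hθ hLs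
  have hcq : ∀ x, c x * q x = (σ * L * m x).trace.re := by
    intro x
    by_cases h0 : m x = 0
    · simp [q, outcomeDensity, h0]
    · have hqx : q x ≠ 0 := (re_trace_mul_pos hσ (hm.posSemidef x) h0).ne'
      rw [hc, div_mul_cancel₀ _ hqx]
  set g : 𝒳 → ℝ := fun x => ((L - (c x : ℂ) • 1) * m x * (L - (c x : ℂ) • 1) * σ).trace.re
  have hK : ∀ x, (L - (c x : ℂ) • (1 : Matrix (Fin d) (Fin d) ℂ)).IsHermitian := fun x => by
    refine hLs.1.sub ?_
    rw [IsHermitian, conjTranspose_smul, conjTranspose_one]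
    simp
  have hg0 : ∀ x, 0 ≤ g x := fun x =>
    re_trace_mul_mul_mul_nonneg hσ.posSemidef (hm.posSemidef x) (hK x)
  have hg : ∀ x, g x = reTraceMul L (L * σ) (m x) - c x * c x * q x := by
    intro x
    have h := re_trace_sub_smul hσ.isHermitian hLs.1 (hm.posSemidef x).isHermitian (c x)
    rw [← hcq] at h
    have hq : (σ * m x).trace.re = q x := rfl
    rw [hq] at h
    rw [show g x = _ from h, reTraceMul_apply]
    simp only [Matrix.mul_assoc]
    ring
  have hu : Integrable (fun x => reTraceMul L (L * σ) (m x)) ν := hm.integrable_linearMap _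
  have hq : AEStronglyMeasurable q ν := by
    have : q = fun x => reTraceMul σ 1 (m x) := by
      funext x; rw [reTraceMul_apply, Matrix.mul_one]; rfl
    rw [this]
    exact (hm.integrable_linearMap _).aestronglyMeasurable
  have ht : AEStronglyMeasurable (fun x => (σ * L * m x).trace.re) ν := by
    have : (fun x => (σ * L * m x).trace.re) = fun x => reTraceMul (σ * L) 1 (m x) := by
      funext x; rw [reTraceMul_apply, Matrix.mul_one]
    rw [this]
    exact (hm.integrable_linearMap _).aestronglyMeasurable
  have hcm : AEStronglyMeasurable c ν := by
    rw [show c = fun x => (σ * L * m x).trace.re / q x from funext hc]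
    exact (ht.aemeasurable.div hq.aemeasurable).aestronglyMeasurable
  have hf0 : ∀ x, 0 ≤ c x * c x * q x := fun x =>
    mul_nonneg (mul_self_nonneg _) (by
      by_cases h0 : m x = 0
      · simp [q, outcomeDensity, h0]
      · exact (re_trace_mul_pos hσ (hm.posSemidef x) h0).le)
  have hf : Integrable (fun x => c x * c x * q x) ν := by
    refine hu.mono ((hcm.mul hcm).mul hq) (Filter.Eventually.of_forall fun x => ?_)
    have h1 := hg0 x
    rw [hg] at h1
    rw [Real.norm_of_nonneg (hf0 x)]
    exact (sub_nonneg.1 h1).trans (le_abs_self _)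
  have hint : ∫ x, g x ∂ν = 0 := by
    simp_rw [hg]
    rw [integral_sub hu hf, hm.integral_linearMap, sub_eq_zero]
    refine Eq.trans ?_ hI.symm
    have e : (L * (1 * (L * σ))).trace = (L * σ * L).trace := by
      rw [Matrix.one_mul, Matrix.trace_mul_comm]
    change (L * (1 * (L * σ))).trace.re = 1 / 2 * (L * σ * L + L * σ * L).trace.re
    rw [e, trace_add, Complex.add_re]
    ring
  have hgi : Integrable g ν := by
    rw [show g = fun x => _ from funext hg]
    exact hu.sub hf
  filter_upwards [(integral_eq_zero_iff_of_nonneg hg0 hgi).1 hint] with x hx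
  have h := mul_eq_zero_of_re_trace_eq_zero hσ (hm.posSemidef x) (hK x) hx
  rwa [Matrix.sub_mul, smul_mul_assoc, Matrix.one_mul, sub_eq_zero] at h

/-- Two matrices that act on the density of a measurement by scalars commute with each other, since
the values of the density integrate to the identity. -/
theorem commute_of_ae_mul_eq_smul {𝒳 : Type*} [MeasurableSpace 𝒳] {M : Measurement 𝒳 d}
    {ν : Measure 𝒳} {m : 𝒳 → Matrix (Fin d) (Fin d) ℂ} (hm : M.IsDensity ν m)
    {A B : Matrix (Fin d) (Fin d) ℂ} {a b : 𝒳 → ℂ} (hA : ∀ᵐ x ∂ν, A * m x = a x • m x)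
    (hB : ∀ᵐ x ∂ν, B * m x = b x • m x) : Commute A B := by
  have h : ∀ᵐ x ∂ν, (A * B - B * A) * m x = 0 := by
    filter_upwards [hA, hB] with x h1 h2
    rw [Matrix.sub_mul, Matrix.mul_assoc, Matrix.mul_assoc, h1, h2, mul_smul_comm, mul_smul_comm,
      h1, h2, smul_smul, smul_smul, mul_comm, sub_self]
  rw [Commute, SemiconjBy, ← sub_eq_zero]
  ext i j
  have h1 := hm.integral_linearMap
    (Matrix.entryLinearMap ℝ ℂ i j ∘ₗ LinearMap.mulLeft ℝ (A * B - B * A))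
  have h2 : ∫ x, (Matrix.entryLinearMap ℝ ℂ i j ∘ₗ
      LinearMap.mulLeft ℝ (A * B - B * A)) (m x) ∂ν = 0 := by
    refine integral_eq_zero_of_ae ?_
    filter_upwards [h] with x hx
    simp [hx]
  rw [h2] at h1
  simpa using h1.symm

end Attainment

/-! ### Integration of the score equation -/

section Integration

open Matrix

/-- A solution on a connected open set of `∂f/∂θʳ = (∂u/∂θʳ) f` is a constant multiple of
`exp u`. -/
theorem eq_exp_mul_of_fderiv_eq {p : ℕ} {Θ : Set (Fin p → ℝ)} (hΘ : IsOpen Θ)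
    (hc : IsPreconnected Θ) {f : (Fin p → ℝ) → ℂ} {u : (Fin p → ℝ) → ℝ}
    (hf : ∀ θ ∈ Θ, DifferentiableAt ℝ f θ) (hu : ∀ θ ∈ Θ, DifferentiableAt ℝ u θ)
    (h : ∀ θ ∈ Θ, ∀ r : Fin p, fderiv ℝ f θ (Pi.single r 1) =
      (fderiv ℝ u θ (Pi.single r 1) : ℝ) * f θ)
    {θ₀ θ : Fin p → ℝ} (hθ₀ : θ₀ ∈ Θ) (hθ : θ ∈ Θ) :
    f θ = (Real.exp (u θ - u θ₀) : ℝ) * f θ₀ := by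
  have hd : ∀ θ ∈ Θ, HasFDerivAt (fun η => Real.exp (-u η) • f η)
      (Real.exp (-u θ) • fderiv ℝ f θ +
        (Real.exp (-u θ) • -fderiv ℝ u θ).smulRight (f θ)) θ := fun θ hθ =>
    (hu θ hθ).hasFDerivAt.neg.exp.smul (hf θ hθ).hasFDerivAt
  have hconst := hΘ.is_const_of_fderiv_eq_zero (𝕜 := ℝ) hc
    (fun θ hθ => (hd θ hθ).differentiableAt.differentiableWithinAt) (fun θ hθ => by
      rw [(hd θ hθ).fderiv]
      refine ContinuousLinearMap.coe_injective ((Pi.basisFun ℝ (Fin p)).ext fun r => ?_)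
      simp [h θ hθ r, mul_assoc]) hθ hθ₀
  simp only [Complex.real_smul] at hconst
  have e : ((Real.exp (u θ) : ℝ) : ℂ) * (Real.exp (-u θ) : ℝ) = 1 := by
    rw [← Complex.ofReal_mul, ← Real.exp_add, add_neg_cancel, Real.exp_zero, Complex.ofReal_one]
  calc f θ = (Real.exp (u θ) : ℝ) * ((Real.exp (-u θ) : ℝ) * f θ) := by
        rw [← mul_assoc, e, one_mul]
    _ = _ := by
        rw [hconst, ← mul_assoc, ← Complex.ofReal_mul, ← Real.exp_add, sub_eq_add_neg]

/-- In a basis that diagonalizes all quantum scores, with eigenvalues `lᵢ`, the score equation reads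
`∂σᵢⱼ = ½ (lᵢ + lⱼ) σᵢⱼ`. Thus `lᵢ = ∂ log σᵢᵢ`, and the equation integrates to
`σᵢⱼ(θ) = exp (½ (Fᵢ + Fⱼ)) σᵢⱼ(θ₀)` with `Fᵢ = log σᵢᵢ(θ) - log σᵢᵢ(θ₀)`. -/
theorem eq_diagonal_mul_mul_diagonal_of_score_diagonal {p d : ℕ} {Θ : Set (Fin p → ℝ)}
    (hΘ : IsOpen Θ) (hc : IsPreconnected Θ)
    {ρ : (Fin p → ℝ) → Matrix (Fin d) (Fin d) ℂ} (hρ : TwiceDifferentiableOn ρ Θ)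
    (hpos : ∀ θ ∈ Θ, (ρ θ).PosDef) {U : Matrix (Fin d) (Fin d) ℂ}
    (hU : U ∈ unitary (Matrix (Fin d) (Fin d) ℂ))
    (hdiag : ∀ θ ∈ Θ, ∀ r, ∃ l : Fin d → ℂ, Uᴴ * quantumScore ρ r θ * U = diagonal l)
    {θ₀ : Fin p → ℝ} (hθ₀ : θ₀ ∈ Θ) :
    ∃ F : (Fin p → ℝ) → Fin d → ℝ, ∀ θ ∈ Θ, Uᴴ * ρ θ * U =
      diagonal (fun i => Complex.exp ((1 / 2 : ℂ) * F θ i)) * (Uᴴ * ρ θ₀ * U) *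
        diagonal (fun i => Complex.exp ((1 / 2 : ℂ) * F θ i)) := by
  have hU1 : Uᴴ * U = 1 := (Unitary.mem_iff.1 hU).1
  have hU2 : U * Uᴴ = 1 := (Unitary.mem_iff.1 hU).2
  set φ : Fin d → Fin d → Matrix (Fin d) (Fin d) ℂ →ₗ[ℝ] ℂ := fun i j =>
    Matrix.entryLinearMap ℝ ℂ i j ∘ₗ LinearMap.mulRight ℝ U ∘ₗ LinearMap.mulLeft ℝ Uᴴ
  have hφ : ∀ i j N, φ i j N = (Uᴴ * N * U) i j := fun _ _ _ => rfl
  set s : Fin d → (Fin p → ℝ) → ℝ := fun i θ => (φ i i (ρ θ)).re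
  have hσpos : ∀ θ ∈ Θ, (Uᴴ * ρ θ * U).PosDef := fun θ hθ =>
    (hpos θ hθ).conjTranspose_mul_mul_same fun v w h => by
      have := congrArg (Uᴴ *ᵥ ·) h
      simpa [mulVec_mulVec, hU1] using this
  have hs : ∀ i, ∀ θ ∈ Θ, 0 < s i θ := fun i θ hθ =>
    (Complex.lt_def.1 (hσpos θ hθ).diag_pos).1
  have hsφ : ∀ i, ∀ θ ∈ Θ, φ i i (ρ θ) = s i θ := fun i θ hθ =>
    Complex.ext rfl (Complex.lt_def.1 (hσpos θ hθ).diag_pos).2.symm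
  have hφd : ∀ i j, ∀ θ ∈ Θ, DifferentiableAt ℝ (fun η => φ i j (ρ η)) θ := fun i j θ hθ =>
    differentiableAt_linearMap_comp hρ hθ _
  have hsd : ∀ i, ∀ θ ∈ Θ, DifferentiableAt ℝ (s i) θ := fun i θ hθ =>
    differentiableAt_linearMap_comp hρ hθ (Complex.reLm ∘ₗ φ i i)
  have hlog : ∀ i, ∀ θ ∈ Θ, DifferentiableAt ℝ (fun η => Real.log (s i η)) θ := fun i θ hθ =>
    (hsd i θ hθ).log (hs i θ hθ).ne'
  -- The score equation in the diagonalizing basis, with real eigenvalues.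
  have hscore : ∀ θ ∈ Θ, ∀ r, ∃ l : Fin d → ℝ, ∀ i j,
      φ i j (partialDeriv ρ r θ) = ((1 / 2 * (l i + l j) : ℝ) : ℂ) * φ i j (ρ θ) := by
    intro θ hθ r
    obtain ⟨l, hl⟩ := hdiag θ hθ r
    have hL := isQuantumScore_quantumScore hΘ hρ hpos hθ r
    have hlr : ∀ i, ((l i).re : ℂ) = l i := by
      have hh := isHermitian_conjTranspose_mul_mul U hL.1
      rw [hl] at hh
      intro i
      exact Complex.conj_eq_iff_re.1 (isHermitian_diagonal_iff.1 hh i)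
    refine ⟨fun i => (l i).re, fun i j => ?_⟩
    have e1 : Uᴴ * (ρ θ * quantumScore ρ r θ) * U = (Uᴴ * ρ θ * U) * diagonal l := by
      rw [← hl]
      calc _ = Uᴴ * ρ θ * 1 * quantumScore ρ r θ * U := by
            simp only [Matrix.mul_one, Matrix.mul_assoc]
        _ = _ := by rw [← hU2]; simp only [Matrix.mul_assoc]
    have e2 : Uᴴ * (quantumScore ρ r θ * ρ θ) * U = diagonal l * (Uᴴ * ρ θ * U) := by
      rw [← hl]
      calc _ = Uᴴ * quantumScore ρ r θ * 1 * ρ θ * U := by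
            simp only [Matrix.mul_one, Matrix.mul_assoc]
        _ = _ := by rw [← hU2]; simp only [Matrix.mul_assoc]
    rw [hφ, hφ, hL.2, mul_smul_comm, smul_mul_assoc, Matrix.mul_add, Matrix.add_mul, e1, e2,
      Matrix.smul_apply, Matrix.add_apply, mul_diagonal, diagonal_mul, smul_eq_mul]
    push_cast
    rw [hlr, hlr]
    ring
  have hlogd : ∀ θ ∈ Θ, ∀ r (l : Fin d → ℝ), (∀ i j, φ i j (partialDeriv ρ r θ) =
      ((1 / 2 * (l i + l j) : ℝ) : ℂ) * φ i j (ρ θ)) → ∀ i,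
      fderiv ℝ (fun η => Real.log (s i η)) θ (Pi.single r 1) = l i := by
    intro θ hθ r l hl i
    have h1 : fderiv ℝ (s i) θ (Pi.single r 1) = l i * s i θ := by
      have h2 := fderiv_linearMap_comp hρ hθ (Complex.reLm ∘ₗ φ i i) r
      refine h2.trans ?_
      change (φ i i (partialDeriv ρ r θ)).re = _
      rw [hl, Complex.re_ofReal_mul]
      change _ * s i θ = _
      ring
    rw [fderiv.log (hsd i θ hθ) (hs i θ hθ).ne', _root_.smul_apply, h1, smul_eq_mul,
      mul_comm (l i), inv_mul_cancel_left₀ (hs i θ hθ).ne']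
  refine ⟨fun θ i => Real.log (s i θ) - Real.log (s i θ₀), fun θ hθ => ?_⟩
  ext i j
  have key := eq_exp_mul_of_fderiv_eq hΘ hc (hφd i j)
    (u := fun η => (1 / 2 : ℝ) • (Real.log (s i η) + Real.log (s j η)))
    (fun θ hθ => ((hlog i θ hθ).fun_add (hlog j θ hθ)).fun_const_smul _) (fun θ hθ r => by
      obtain ⟨l, hl⟩ := hscore θ hθ r
      rw [fderiv_linearMap_comp hρ hθ, hl,
        fderiv_fun_const_smul ((hlog i θ hθ).fun_add (hlog j θ hθ)),
        fderiv_fun_add (hlog i θ hθ) (hlog j θ hθ), _root_.smul_apply, _root_.add_apply,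
        hlogd θ hθ r l hl, hlogd θ hθ r l hl, smul_eq_mul]) hθ₀ hθ
  rw [hφ, hφ] at key
  rw [key, mul_diagonal, diagonal_mul, mul_right_comm, ← Complex.exp_add, Complex.ofReal_exp]
  congr 2
  simp only [smul_eq_mul]
  push_cast
  ring

end Integration

end QuantumStat

theorem theorem3 {p d : ℕ} {𝒳 : Type*} [MeasurableSpace 𝒳]
    (Θ : Set (Fin p → ℝ)) (hΘ_open : IsOpen Θ) (hΘ_sc : IsSimplyConnected Θ)
    (ρ : (Fin p → ℝ) → Matrix (Fin d) (Fin d) ℂ)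
    (hρ_state : ∀ θ ∈ Θ, QuantumStat.IsState (ρ θ))
    (hρ_diff : QuantumStat.TwiceDifferentiableOn ρ Θ)
    (hρ_pos : ∀ θ ∈ Θ, (ρ θ).PosDef)
    (M : QuantumStat.Measurement 𝒳 d)
    (hM : ∀ θ ∈ Θ, M.fisherInfo ρ θ = QuantumStat.quantumInfo ρ θ)
    (θ₀ : Fin p → ℝ) (hθ₀ : θ₀ ∈ Θ) :
    ∃ X : Matrix (Fin d) (Fin d) ℂ, X.IsHermitian ∧
      ∃ F : ℝ → (Fin p → ℝ) → ℝ, ∀ θ ∈ Θ,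
        ρ θ = NormedSpace.exp ((1 / 2 : ℝ) • cfc (fun x => F x θ) X) * ρ θ₀ *
          NormedSpace.exp ((1 / 2 : ℝ) • cfc (fun x => F x θ) X) := by
  open QuantumStat Matrix in
  have hae : ∀ i : Fin p × Θ, ∀ᵐ x ∂M.traceMeasure, quantumScore ρ i.1 i.2.1 * M.density x =
      ((score ρ M.density i.1 x i.2.1 : ℝ) : ℂ) • M.density x := fun i =>
    ae_quantumScore_mul_density M.isDensity_density hΘ_open hρ_diff hρ_pos i.2.2 i.1
      (congrFun (congrFun (hM _ i.2.2) i.1) i.1)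
  obtain ⟨U, hU, hdiag⟩ := exists_unitary_forall_eq_diagonal
    (fun i : Fin p × Θ => quantumScore ρ i.1 i.2.1)
    (fun i => (isQuantumScore_quantumScore hΘ_open hρ_diff hρ_pos i.2.2 i.1).1)
    (fun i j => commute_of_ae_mul_eq_smul M.isDensity_density (hae i) (hae j))
  have hU2 : U * Uᴴ = 1 := (Unitary.mem_iff.1 hU).2
  have hU1 : Uᴴ * U = 1 := (Unitary.mem_iff.1 hU).1
  obtain ⟨F, hF⟩ := eq_diagonal_mul_mul_diagonal_of_score_diagonal hΘ_open
    hΘ_sc.isPathConnected.isConnected.isPreconnected hρ_diff hρ_pos hU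
    (fun θ hθ r => hdiag (r, ⟨θ, hθ⟩)) hθ₀
  -- The eigenvalues `0, 1, …, d - 1` of `X` label the vectors of the diagonalizing basis, so that
  -- every diagonal matrix in that basis is a function of `X`.
  have hinj : Function.Injective (fun i : Fin d => ((i : ℕ) : ℝ)) := fun i j h =>
    Fin.ext (Nat.cast_injective h)
  refine ⟨U * diagonal (fun i : Fin d => (((i : ℕ) : ℝ) : ℂ)) * Uᴴ,
    isHermitian_mul_diagonal_mul_conjTranspose U _,
    fun x θ => Function.extend (fun i : Fin d => ((i : ℕ) : ℝ)) (F θ) 0 x, fun θ hθ => ?_⟩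
  have hexp : NormedSpace.exp ((1 / 2 : ℝ) • cfc
      (fun x => Function.extend (fun i : Fin d => ((i : ℕ) : ℝ)) (F θ) 0 x)
        (U * diagonal (fun i : Fin d => (((i : ℕ) : ℝ) : ℂ)) * Uᴴ)) =
      U * diagonal (fun i => Complex.exp ((1 / 2 : ℂ) * F θ i)) * Uᴴ := by
    rw [cfc_mul_diagonal_mul_conjTranspose hU, ← exp_mul_diagonal_mul_conjTranspose hU,
      ← smul_mul_assoc, ← mul_smul_comm, ← diagonal_smul]
    congr 4
    funext i
    rw [Pi.smul_apply, hinj.extend_apply, Complex.real_smul]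
    push_cast
    rfl
  rw [hexp]
  calc ρ θ = (U * Uᴴ) * ρ θ * (U * Uᴴ) := by rw [hU2, Matrix.one_mul, Matrix.mul_one]
    _ = U * (Uᴴ * ρ θ * U) * Uᴴ := by simp only [Matrix.mul_assoc]
    _ = _ := by
      rw [hF θ hθ]
      simp only [Matrix.mul_assoc]
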